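/- **Conventions.** Let $K$ be a poset. For $n\ge 0$ let $\widetilde\Delta_n$ be the set of nonempty subsets of $\{0,\dots,n\}$ ordered by inclusion. A singular $n$-simplex of $K$ is an order-preserving map $d:\widetilde\Delta_n\to K$; $\Sigma_n(K)$ denotes the set of these, and $|d|=d(\{0,\dots,n\})$ is the support of $d$. A map $m:\{0,\dots,n\}\to\{0,\dots,p\}$ induces $m^*:\Sigma_p(K)\to\Sigma_n(K)$, $(m^*d)(s)=d(m(s))$. The boundary $\partial_i:\Sigma_n(K)\to\Sigma_{n-1}(K)$ is induced by the increasing injection omitting the value $i$, and the degeneracy $\sigma_i:\Sigma_n(K)\to\Sigma_{n+1}(K)$ by the nondecreasing surjection taking the value $i$ twice. A $0$-simplex $a$ is identified with the element $|a|$ of $K$. The reverse $\overline b$ of a $1$-simplex $b$ is the $1$-simplex with the same support and $\partial_0\overline b=\partial_1b$, $\partial_1\overline b=\partial_0b$. A path $p$ from $\partial_1p=a_0$ to $\partial_0p=a_1$ is a finite sequence $\{b_n,\dots,b_1\}$, $n\ge1$, of $1$-simplices with $\partial_1b_1=a_0$, $\partial_0b_i=\partial_1b_{i+1}$ for $1\le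 i<n$, and $\partial_0b_n=a_1$. The composite $q*p$ (first $p$, then $q$) is the concatenation, and $\overline p=\{\overline b_1,\dots,\overline b_n\}$. An elementary deformation replaces a member $\partial_1c$ of a path by the consecutive pair $\partial_0c,\partial_2c$, where $c\in\Sigma_2(K)$, or conversely; two paths with the same endpoints are homotopic if finitely many elementary deformations transform one into the other. $\pi_1(K,a_0)$ is the group of homotopy classes of paths from $a_0$ to $a_0$, with $[p]\cdot[q]=[p*q]$, identity $[\sigma_0(a_0)]$ and inverse $[p]^{-1}=[\overline p]$. Let $G$ be a group. For a map $v:\Sigma_1(K)\to G$ (a $1$-cochain) and a path $p=\{b_n,\dots,b_1\}$ put $v(p)=v(b_n)\cdots v(b_1)$. $\mathrm Z^1(K,G)$ is the category whose objects are the $1$-cocycles, i.e. the maps $z:\Sigma_1(K)\to G$ with $z(\partial_0c)\,z(\partial_2c)=z(\partial_1c)$ for all $c\in\Sigma_2(K)$; a morphism from $z_1$ to $z$ is a map $\mathrm f:\Sigma_0(K)\to G$ with $\mathrm f_{\partial_0p}\,z_1(p)=z(p)\,\mathrm f_{\partial_1p}$ for all paths $p$; morphisms compose by pointwise multiplication.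 For a group $S$, $H(S,G)$ is the category whose objects are the group homomorphisms $S\to G$; a morphism from $\sigma_1$ to $\sigma$ is an element $h\in G$ with $h\,\sigma_1(g)=\sigma(g)\,h$ for all $g\in S$; morphisms compose by multiplication in $G$. **Corollary 3.9.** Let $M$ be a nonempty, arcwise connected Hausdorff topological space, and let $K$ be a base for the topology of $M$ consisting of nonempty, arcwise connected and simply connected open subsets of $M$, regarded as a poset under inclusion. Let $G$ be a group, $x_0\in M$, and let $a_0$ be a $0$-simplex of $K$, i.e. an element of $K$, with $x_0\in a_0$. Then the category $H(\pi_1(M,x_0),G)$ is equivalent to $H(\pi_1(K,a_0),G)$, and $H(\pi_1(K,a_0),G)$ is equivalent to $\mathrm Z^1(K,G)$. -/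

import Mathlib

open CategoryTheory

namespace PosetCohomology

universe u v w

/-! ### Singular simplices of a poset -/

/-- The poset of nonempty subsets of `{0, 1, …, n}`, ordered by inclusion. -/
abbrev NonemptySubsets (n : ℕ) : Type :=
  {s : Finset (Fin (n + 1)) // s.Nonempty}

/-- The order preserving map on nonempty subsets induced by a map `m : {0,…,n} → {0,…,p}`. -/
def NonemptySubsets.map {n p : ℕ} (m : Fin (n + 1) → Fin (p + 1)) :
    NonemptySubsets n →o NonemptySubsets p where
  toFun s := ⟨s.1.image m, s.2.image m⟩
  monotone' _ _ h := Finset.image_subset_image h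

/-- A singular `n`-simplex of the poset `K`: an order preserving map from the nonempty subsets
of `{0, …, n}` to `K`. -/
structure Simplex (K : Type u) [PartialOrder K] (n : ℕ) : Type u where
  toHom : NonemptySubsets n →o K

namespace Simplex

variable {K : Type u} [PartialOrder K]

/-- The map `m^*` of simplices induced by `m : {0,…,n} → {0,…,p}`. -/
def pull {n p : ℕ} (m : Fin (n + 1) → Fin (p + 1)) (d : Simplex K p) : Simplex K n :=
  ⟨d.toHom.comp (NonemptySubsets.map m)⟩

/-- The boundary `∂ᵢ d`, induced by the injective monotone map that omits the value `i`. -/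
def face {n : ℕ} (i : Fin (n + 2)) (d : Simplex K (n + 1)) : Simplex K n :=
  d.pull i.succAbove

/-- The degeneracy `σᵢ d`, induced by the surjective monotone map that takes the value `i`
twice. -/
def degen {n : ℕ} (i : Fin (n + 1)) (d : Simplex K n) : Simplex K (n + 1) :=
  d.pull i.predAbove

/-- The support `|d|`: the value of `d` at the whole set `{0, …, n}`. For a `0`-simplex this is
the element of the poset with which the simplex is identified. -/
def support {n : ℕ} (d : Simplex K n) : K :=
  d.toHom ⟨Finset.univ, Finset.univ_nonempty⟩

/-- The reverse of a `1`-simplex: same support, vertices exchanged. -/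
def reverse (b : Simplex K 1) : Simplex K 1 :=
  b.pull Fin.rev

/-- A `0`-simplex is the same thing as an element of the poset. -/
def zeroEquiv : Simplex K 0 ≃ K where
  toFun := support
  invFun a := ⟨OrderHom.const _ a⟩
  left_inv d := by
    cases d with
    | mk f =>
      refine congrArg Simplex.mk (OrderHom.ext _ _ (funext fun s => ?_))
      have hs : s = ⟨Finset.univ, Finset.univ_nonempty⟩ := by
        obtain ⟨s, x, hx⟩ := s
        apply Subtype.ext
        apply Finset.ext
        intro y
        have hy : y = x := Fin.ext (by omega)
        subst hy
        exact ⟨fun _ => Finset.mem_univ _, fun _ => hx⟩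
      subst hs
      rfl
  right_inv _ := rfl

theorem pull_pull {n p q : ℕ} (m : Fin (n + 1) → Fin (p + 1)) (m' : Fin (p + 1) → Fin (q + 1))
    (d : Simplex K q) : (d.pull m').pull m = d.pull (m' ∘ m) := by
  unfold pull
  congr 1
  apply OrderHom.ext
  funext s
  exact congrArg d.toHom (Subtype.ext Finset.image_image)

theorem pull_id {n : ℕ} (d : Simplex K n) : d.pull id = d := by
  cases d
  unfold pull
  congr 1
  ext s
  simp [NonemptySubsets.map]

theorem pull_eq_self {n : ℕ} (m : Fin (n + 1) → Fin (n + 1)) (h : m = id) (d : Simplex K n) :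
    d.pull m = d := by
  rw [h, pull_id]

theorem pull_congr {n p : ℕ} {m m' : Fin (n + 1) → Fin (p + 1)} (h : m = m') (d : Simplex K p) :
    d.pull m = d.pull m' := by
  rw [h]

theorem face_zero_reverse (b : Simplex K 1) : b.reverse.face 0 = b.face 1 := by
  unfold face reverse
  rw [pull_pull]
  exact pull_congr (by decide) b

theorem face_one_reverse (b : Simplex K 1) : b.reverse.face 1 = b.face 0 := by
  unfold face reverse
  rw [pull_pull]
  exact pull_congr (by decide) b

theorem face_degen_zero (i : Fin 2) (a : Simplex K 0) : (a.degen 0).face i = a := by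
  unfold face degen
  rw [pull_pull]
  exact pull_eq_self _ (funext fun _ => Fin.ext (by omega)) a

end Simplex

/-! ### Paths and their homotopy -/

section Paths

variable {K : Type u} [PartialOrder K]

/-- A path from `a₀` to `a₁`: a nonempty finite sequence `[bₙ, …, b₁]` of `1`-simplices with
`∂₁ b₁ = a₀`, `∂₀ bᵢ = ∂₁ bᵢ₊₁` and `∂₀ bₙ = a₁`. The `1`-simplex that is travelled first stands
last in the list. -/
@[ext]
structure SPath (a₀ a₁ : Simplex K 0) : Type u where
  simplices : List (Simplex K 1)
  ne_nil : simplices ≠ []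
  source : (simplices.getLast ne_nil).face 1 = a₀
  chain : simplices.IsChain (fun b' b => b.face 0 = b'.face 1)
  target : (simplices.head ne_nil).face 0 = a₁

namespace SPath

/-- A `1`-simplex as a path of length one. -/
def single (b : Simplex K 1) : SPath (b.face 1) (b.face 0) where
  simplices := [b]
  ne_nil := by simp
  source := rfl
  chain := by simp
  target := rfl

/-- The constant path at `a`, consisting of the degenerate `1`-simplex `σ₀ a`. -/
def const (a : Simplex K 0) : SPath a a where
  simplices := [a.degen 0]
  ne_nil := by simp
  source := Simplex.face_degen_zero 1 a
  chain := by simp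
  target := Simplex.face_degen_zero 0 a

/-- The composition `q * p`: first `p`, then `q`. -/
def comp {a₀ a₁ a₂ : Simplex K 0} (q : SPath a₁ a₂) (p : SPath a₀ a₁) : SPath a₀ a₂ where
  simplices := q.simplices ++ p.simplices
  ne_nil := by simp [p.ne_nil]
  source := by
    rw [List.getLast_append_of_ne_nil _ p.ne_nil]
    exact p.source
  chain := by
    rw [List.isChain_append]
    refine ⟨q.chain, p.chain, ?_⟩
    intro x hx y hy
    rw [List.getLast?_eq_getLast_of_ne_nil q.ne_nil] at hx
    rw [List.head?_eq_some_head p.ne_nil] at hy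
    simp only [Option.mem_def, Option.some.injEq] at hx hy
    rw [← hx, ← hy, p.target, q.source]
  target := by
    rw [List.head_append_of_ne_nil q.ne_nil]
    exact q.target

/-- The reverse path `[b̄₁, …, b̄ₙ]` of `[bₙ, …, b₁]`. -/
def reverse {a₀ a₁ : Simplex K 0} (p : SPath a₀ a₁) : SPath a₁ a₀ where
  simplices := (p.simplices.map Simplex.reverse).reverse
  ne_nil := by simp [p.ne_nil]
  source := by
    rw [List.getLast_reverse, List.head_map, Simplex.face_one_reverse]
    exact p.target
  chain := by
    rw [List.isChain_reverse, List.isChain_map]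
    refine p.chain.imp ?_
    intro b' b h
    simp only [Simplex.face_zero_reverse, Simplex.face_one_reverse]
    exact h.symm
  target := by
    rw [List.head_reverse, List.getLast_map, Simplex.face_zero_reverse]
    exact p.source

/-- `q` arises from `p` by an elementary deformation that replaces a `1`-simplex `∂₁ c` of `p`
by the pair `∂₀ c, ∂₂ c`, where `c` is a `2`-simplex. -/
def ElementaryDeformation {a₀ a₁ : Simplex K 0} (p q : SPath a₀ a₁) : Prop :=
  ∃ (l r : List (Simplex K 1)) (c : Simplex K 2),
    p.simplices = l ++ [c.face 1] ++ r ∧ q.simplices = l ++ [c.face 0, c.face 2] ++ r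

/-- Homotopy of paths with the same endpoints: the equivalence relation generated by the
elementary deformations. -/
def Homotopic {a₀ a₁ : Simplex K 0} (p q : SPath a₀ a₁) : Prop :=
  Relation.EqvGen ElementaryDeformation p q

/-- Homotopy as a setoid. -/
def homotopySetoid (a₀ a₁ : Simplex K 0) : Setoid (SPath a₀ a₁) :=
  Relation.EqvGen.setoid ElementaryDeformation

theorem comp_assoc {a₀ a₁ a₂ a₃ : Simplex K 0} (r : SPath a₂ a₃) (q : SPath a₁ a₂)
    (p : SPath a₀ a₁) : (r.comp q).comp p = r.comp (q.comp p) := by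
  ext1
  simp [comp]

theorem Homotopic.map {a₀ a₁ a₂ a₃ : Simplex K 0} {F : SPath a₀ a₁ → SPath a₂ a₃}
    (hF : ∀ p q, ElementaryDeformation p q → ElementaryDeformation (F p) (F q))
    {p q : SPath a₀ a₁} (h : Homotopic p q) : Homotopic (F p) (F q) := by
  induction h with
  | rel _ _ h => exact .rel _ _ (hF _ _ h)
  | refl _ => exact .refl _
  | symm _ _ _ ih => exact .symm _ _ ih
  | trans _ _ _ _ _ ih₁ ih₂ => exact .trans _ _ _ ih₁ ih₂

theorem Homotopic.comp_left {a₀ a₁ a₂ : Simplex K 0} (r : SPath a₁ a₂) {p q : SPath a₀ a₁}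
    (h : Homotopic p q) : Homotopic (r.comp p) (r.comp q) := by
  refine h.map (F := fun p => r.comp p) ?_
  rintro p q ⟨l, s, c, hp, hq⟩
  exact ⟨r.simplices ++ l, s, c, by simp [comp, hp], by simp [comp, hq]⟩

theorem Homotopic.comp_right {a₀ a₁ a₂ : Simplex K 0} {p q : SPath a₁ a₂} (h : Homotopic p q)
    (r : SPath a₀ a₁) : Homotopic (p.comp r) (q.comp r) := by
  refine h.map (F := fun p => p.comp r) ?_
  rintro p q ⟨l, s, c, hp, hq⟩
  exact ⟨l, s ++ r.simplices, c, by simp [comp, hp], by simp [comp, hq]⟩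

theorem Homotopic.reverse {a₀ a₁ : Simplex K 0} {p q : SPath a₀ a₁} (h : Homotopic p q) :
    Homotopic p.reverse q.reverse := by
  refine h.map (F := fun p => p.reverse) ?_
  rintro p q ⟨l, s, c, hp, hq⟩
  have h₀ : (c.pull Fin.rev).face 0 = (c.face 2).reverse := by
    unfold Simplex.face Simplex.reverse
    rw [Simplex.pull_pull, Simplex.pull_pull]
    exact Simplex.pull_congr (by decide) c
  have h₁ : (c.pull Fin.rev).face 1 = (c.face 1).reverse := by
    unfold Simplex.face Simplex.reverse
    rw [Simplex.pull_pull, Simplex.pull_pull]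
    exact Simplex.pull_congr (by decide) c
  have h₂ : (c.pull Fin.rev).face 2 = (c.face 0).reverse := by
    unfold Simplex.face Simplex.reverse
    rw [Simplex.pull_pull, Simplex.pull_pull]
    exact Simplex.pull_congr (by decide) c
  refine ⟨(s.map Simplex.reverse).reverse, (l.map Simplex.reverse).reverse, c.pull Fin.rev, ?_, ?_⟩
  · simp [SPath.reverse, hp, h₁]
  · simp [SPath.reverse, hq, h₀, h₂]

theorem const_comp {a₀ a₁ : Simplex K 0} (p : SPath a₀ a₁) :
    Homotopic ((const a₁).comp p) p := by
  refine .symm _ _ (.rel _ _ ?_)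
  obtain ⟨l, hl, hs, hc, ht⟩ := p
  cases l with
  | nil => exact absurd rfl hl
  | cons b l =>
    have h₀ : (b.degen 1).face 0 = a₁.degen 0 := by
      rw [← ht]
      simp only [List.head_cons]
      unfold Simplex.face Simplex.degen
      rw [Simplex.pull_pull, Simplex.pull_pull]
      exact Simplex.pull_congr (by decide) b
    have h₁ : (b.degen 1).face 1 = b := by
      unfold Simplex.face Simplex.degen
      rw [Simplex.pull_pull]
      exact Simplex.pull_eq_self _ (by decide) b
    have h₂ : (b.degen 1).face 2 = b := by
      unfold Simplex.face Simplex.degen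
      rw [Simplex.pull_pull]
      exact Simplex.pull_eq_self _ (by decide) b
    exact ⟨[], l, b.degen 1, by simp [h₁], by simp [comp, const, h₀, h₂]⟩

theorem single_reverse_comp (b : Simplex K 1) :
    Homotopic ((single b).reverse.comp (single b)) (const (b.face 1)) := by
  refine .symm _ _ (.rel _ _ ?_)
  have h₀ : (b.pull (![0, 1, 0] : Fin 3 → Fin 2)).face 0 = b.reverse := by
    unfold Simplex.face Simplex.reverse
    rw [Simplex.pull_pull]
    exact Simplex.pull_congr (by decide) b
  have h₁ : (b.pull (![0, 1, 0] : Fin 3 → Fin 2)).face 1 = (b.face 1).degen 0 := by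
    unfold Simplex.face Simplex.degen
    rw [Simplex.pull_pull, Simplex.pull_pull]
    exact Simplex.pull_congr (by decide) b
  have h₂ : (b.pull (![0, 1, 0] : Fin 3 → Fin 2)).face 2 = b := by
    unfold Simplex.face
    rw [Simplex.pull_pull]
    exact Simplex.pull_eq_self _ (by decide) b
  exact ⟨[], [], b.pull ![0, 1, 0], by simp [const, h₁],
    by simp [comp, single, SPath.reverse, h₀, h₂]⟩

theorem reverse_comp {a₀ a₁ : Simplex K 0} (p : SPath a₀ a₁) :
    Homotopic (p.reverse.comp p) (const a₀) := by
  obtain ⟨l, hl, hs, hc, ht⟩ := p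
  induction l generalizing a₁ with
  | nil => exact absurd rfl hl
  | cons b l ih =>
    cases l with
    | nil =>
      simp only [List.getLast_singleton] at hs
      simp only [List.head_cons] at ht
      subst hs ht
      exact single_reverse_comp b
    | cons b' l =>
      simp only [List.head_cons] at ht
      subst ht
      rw [List.isChain_cons_cons] at hc
      let q : SPath a₀ (b.face 1) := ⟨b' :: l, by simp, by simpa using hs, hc.2, hc.1⟩
      have hq : Homotopic (q.reverse.comp q) (const a₀) := ih _ _ _ _
      have e : (SPath.mk (b :: b' :: l) hl hs (List.isChain_cons_cons.2 hc) rfl :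
          SPath a₀ (b.face 0)) = (single b).comp q := by
        ext1
        simp [comp, single, q]
      rw [e]
      have e' : ((single b).comp q).reverse.comp ((single b).comp q) =
          q.reverse.comp (((single b).reverse.comp (single b)).comp q) := by
        ext1
        simp [comp, SPath.reverse]
      rw [e']
      refine .trans _ _ _ (Homotopic.comp_left _
        (Homotopic.comp_right (single_reverse_comp b) q)) ?_
      exact .trans _ _ _ (Homotopic.comp_left _ (const_comp q)) hq

end SPath

end Paths

/-! ### The first homotopy group of a poset -/

/-- The first homotopy group `π₁(K, a₀)`: loops at `a₀` up to homotopy. -/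
def HomotopyGroup {K : Type u} [PartialOrder K] (a₀ : Simplex K 0) : Type u :=
  Quotient (SPath.homotopySetoid a₀ a₀)

namespace HomotopyGroup

variable {K : Type u} [PartialOrder K] {a₀ : Simplex K 0}

/-- The class `[p]` of a loop `p`. -/
def mk (p : SPath a₀ a₀) : HomotopyGroup a₀ :=
  Quotient.mk (SPath.homotopySetoid a₀ a₀) p

/-- The group law is `[p] · [q] = [p * q]`, the unit `[σ₀ a₀]`, the inverse `[p]⁻¹ = [p̄]`. -/
instance : Group (HomotopyGroup a₀) :=
  letI : Mul (HomotopyGroup a₀) :=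
    ⟨Quotient.map₂ SPath.comp fun _ p' hp q _ hq =>
      .trans _ _ _ (SPath.Homotopic.comp_right hp q) (SPath.Homotopic.comp_left p' hq)⟩
  letI : One (HomotopyGroup a₀) := ⟨mk (SPath.const a₀)⟩
  letI : Inv (HomotopyGroup a₀) :=
    ⟨Quotient.map SPath.reverse fun _ _ h => SPath.Homotopic.reverse h⟩
  Group.ofLeftAxioms
    (by
      rintro ⟨p⟩ ⟨q⟩ ⟨r⟩
      exact congrArg mk (SPath.comp_assoc p q r))
    (by
      rintro ⟨p⟩
      exact Quotient.sound (SPath.const_comp p))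
    (by
      rintro ⟨p⟩
      exact Quotient.sound (SPath.reverse_comp p))

theorem mk_mul_mk (p q : SPath a₀ a₀) : mk p * mk q = mk (p.comp q) := rfl

theorem one_eq : (1 : HomotopyGroup a₀) = mk (SPath.const a₀) := rfl

theorem inv_mk (p : SPath a₀ a₀) : (mk p)⁻¹ = mk p.reverse := rfl

theorem mk_eq_mk (p q : SPath a₀ a₀) : mk p = mk q ↔ SPath.Homotopic p q :=
  Quotient.eq (r := SPath.homotopySetoid a₀ a₀)

end HomotopyGroup

/-! ### The category of `1`-cochains and the category of `1`-cocycles -/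

/-- A `1`-cochain of `K` with values in `G`: a function from the `1`-simplices to `G`. -/
@[ext]
structure OneCochain (K : Type u) [PartialOrder K] (G : Type v) : Type (max u v) where
  toFun : Simplex K 1 → G

namespace OneCochain

variable {K : Type u} [PartialOrder K] {G : Type v} [Group G]

/-- The value `v(p) = v(bₙ) ⋯ v(b₁)` of a `1`-cochain on a path `p = [bₙ, …, b₁]`. -/
def onPath (z : OneCochain K G) {a₀ a₁ : Simplex K 0} (p : SPath a₀ a₁) : G :=
  (p.simplices.map z.toFun).prod

/-- A morphism from `z₁` to `z`: a function `f` from the `0`-simplices to `G` such that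
`f(∂₀ p) z₁(p) = z(p) f(∂₁ p)` for all paths `p`. -/
@[ext]
structure Hom (z₁ z : OneCochain K G) : Type (max u v) where
  toFun : Simplex K 0 → G
  comm : ∀ (a₀ a₁ : Simplex K 0) (p : SPath a₀ a₁),
    toFun a₁ * z₁.onPath p = z.onPath p * toFun a₀

/-- Morphisms compose by pointwise multiplication. -/
instance : Category (OneCochain K G) where
  Hom z₁ z := Hom z₁ z
  id z := ⟨fun _ => 1, by simp⟩
  comp f g := ⟨fun a => g.toFun a * f.toFun a, by
    intro a₀ a₁ p
    rw [mul_assoc, f.comm, ← mul_assoc, g.comm, mul_assoc]⟩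
  id_comp f := Hom.ext (funext fun _ => mul_one _)
  comp_id f := Hom.ext (funext fun _ => one_mul _)
  assoc f g h := Hom.ext (funext fun _ => (mul_assoc _ _ _).symm)

/-- The `1`-cocycle identity `z(∂₀ c) z(∂₂ c) = z(∂₁ c)` for all `2`-simplices `c`. -/
def IsCocycle : ObjectProperty (OneCochain K G) := fun z =>
  ∀ c : Simplex K 2, z.toFun (c.face 0) * z.toFun (c.face 2) = z.toFun (c.face 1)

end OneCochain

/-- The category `Z¹(K, G)` of `1`-cocycles: the full subcategory of the category of `1`-cochains
on the `1`-cocycles. -/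
abbrev OneCocycle (K : Type u) [PartialOrder K] (G : Type v) [Group G] : Type (max u v) :=
  (OneCochain.IsCocycle (K := K) (G := G)).FullSubcategory

/-! ### The category of homomorphisms between two groups -/

/-- The objects of the category `H(S, G)`: the group homomorphisms from `S` to `G`. -/
@[ext]
structure HomCat (S : Type w) [Group S] (G : Type v) [Group G] : Type (max w v) where
  hom : S →* G

namespace HomCat

variable {S : Type w} [Group S] {G : Type v} [Group G]

/-- A morphism from `σ₁` to `σ`: an element `h` of `G` with `h σ₁(g) = σ(g) h` for all `g`. -/
@[ext]
structure Hom (σ₁ σ : HomCat S G) : Type v where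
  val : G
  comm : ∀ g : S, val * σ₁.hom g = σ.hom g * val

/-- Morphisms compose by multiplication in `G`. -/
instance : Category (HomCat S G) where
  Hom σ₁ σ := Hom σ₁ σ
  id σ := ⟨1, by simp⟩
  comp f g := ⟨g.val * f.val, by
    intro s
    rw [mul_assoc, f.comm, ← mul_assoc, g.comm, mul_assoc]⟩
  id_comp f := Hom.ext (mul_one _)
  comp_id f := Hom.ext (one_mul _)
  assoc f g h := Hom.ext (mul_assoc _ _ _).symm

end HomCat

end PosetCohomology

/-! The second equivalence is the usual passage between cocycles and representations. Fix a path `w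
a` from `a₀` to each vertex `a`, with `w a₀` null-homotopic. Closing up each 1-simplex along these
paths gives a universal cocycle with values in π₁(K, a₀), whose value on a loop is the class of that
loop. Applying homomorphisms to it defines `homToCocycle`. A cocycle `z` arises up to isomorphism
from `[p] ↦ z(p)`, the isomorphism being `a ↦ z(w a)`.

The first equivalence follows from an isomorphism π₁(K, a₀) ≅ π₁(M, x₀). Choose a point in every
member of K. A 1-simplex `b` is sent to the class of a path inside |b| between the points of its
vertices, closed up to `x₀`. Simple connectedness of |b| makes this class unique, and of |c| makes
the assignment a cocycle (`cochain_isCocycle`), hence a homomorphism on π₁(K, a₀).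

Surjectivity: a loop in M is subdivided until each piece lies in a member of K, and the members so
met are linked by a path of K (`toMonoidHom_surjective`).

Injectivity: the universal cocycle glues a covering space of M with discrete fibre π₁(K, a₀).
Monodromy along the image of a loop `p` multiplies the fibre coordinate by `[p]`
(`monodromy_onPath`), so the image determines `[p]`. -/

open CategoryTheory

namespace PosetCohomology

universe u v w

/-! ### Cones -/

namespace Simplex

variable {K : Type u} [PartialOrder K]

/-- The set of the elements of a subset of `{0, …, n + 1}` that lie in `{0, …, n}`. -/
def restrict {n : ℕ} (s : Finset (Fin (n + 2))) : Finset (Fin (n + 1)) :=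
  Finset.univ.filter fun i => i.castSucc ∈ s

theorem mem_restrict {n : ℕ} {s : Finset (Fin (n + 2))} {i : Fin (n + 1)} :
    i ∈ restrict s ↔ i.castSucc ∈ s := by
  simp [restrict]

theorem restrict_nonempty {n : ℕ} (s : NonemptySubsets (n + 1)) (hs : Fin.last (n + 1) ∉ s.1) :
    (restrict s.1).Nonempty := by
  obtain ⟨i, hi⟩ := s.2
  induction i using Fin.lastCases with
  | last => exact absurd hi hs
  | cast i => exact ⟨i, by simpa [restrict] using hi⟩

theorem le_support {n : ℕ} (d : Simplex K n) (s : NonemptySubsets n) : d.toHom s ≤ d.support :=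
  d.toHom.monotone (Finset.subset_univ _)

theorem support_face_le {n : ℕ} (d : Simplex K (n + 1)) (i : Fin (n + 2)) :
    (d.face i).support ≤ d.support :=
  d.le_support _

open Classical in
/-- The cone over the simplex `d`, whose additional, last vertex is an element of `K` above the
support of `d`. -/
noncomputable def cone {n : ℕ} (d : Simplex K n) (m : K) (h : d.support ≤ m) :
    Simplex K (n + 1) where
  toHom :=
    { toFun := fun s => if hs : Fin.last (n + 1) ∈ s.1 then m
        else d.toHom ⟨restrict s.1, restrict_nonempty s hs⟩
      monotone' := by
        intro s t hst
        dsimp only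
        by_cases ht : Fin.last (n + 1) ∈ t.1
        · rw [dif_pos ht]
          split_ifs
          · exact le_rfl
          · exact (d.le_support _).trans h
        · have hs : Fin.last (n + 1) ∉ s.1 := fun hs => ht (hst hs)
          rw [dif_neg ht, dif_neg hs]
          refine d.toHom.monotone ?_
          intro i hi
          simp only [restrict, Finset.mem_filter, Finset.mem_univ, true_and] at hi ⊢
          exact hst hi }

theorem ext_toHom {n : ℕ} {d e : Simplex K n} (h : ∀ s, d.toHom s = e.toHom s) : d = e := by
  cases d
  cases e
  congr 1
  ext s
  exact h s

theorem cone_apply_of_mem {n : ℕ} (d : Simplex K n) (m : K) (h : d.support ≤ m)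
    (s : NonemptySubsets (n + 1)) (hs : Fin.last (n + 1) ∈ s.1) :
    (d.cone m h).toHom s = m :=
  dif_pos hs

theorem cone_apply_of_notMem {n : ℕ} (d : Simplex K n) (m : K) (h : d.support ≤ m)
    (s : NonemptySubsets (n + 1)) (hs : Fin.last (n + 1) ∉ s.1) :
    (d.cone m h).toHom s = d.toHom ⟨restrict s.1, restrict_nonempty s hs⟩ :=
  dif_neg hs

theorem support_cone {n : ℕ} (d : Simplex K n) (m : K) (h : d.support ≤ m) :
    (d.cone m h).support = m :=
  d.cone_apply_of_mem m h _ (Finset.mem_univ _)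

theorem face_last_cone {n : ℕ} (d : Simplex K n) (m : K) (h : d.support ≤ m) :
    (d.cone m h).face (Fin.last (n + 1)) = d := by
  apply ext_toHom
  intro s
  refine (d.cone_apply_of_notMem m h (NonemptySubsets.map _ s) (by simp [NonemptySubsets.map])).trans ?_
  congr 1
  apply Subtype.ext
  ext i
  simp [restrict, NonemptySubsets.map]

/-- Omitting a vertex other than the apex commutes with coning, because the face map fixes the last
vertex and acts on the others as a face map of the base. -/
theorem face_castSucc_cone {n : ℕ} (d : Simplex K (n + 1)) (m : K) (h : d.support ≤ m)
    (i : Fin (n + 2)) :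
    (d.cone m h).face i.castSucc = (d.face i).cone m ((d.support_face_le i).trans h) := by
  apply ext_toHom
  intro s
  have hl : i.castSucc.succAbove (Fin.last (n + 1)) = Fin.last (n + 2) := by
    simp
  have h1 : Fin.last (n + 2) ∈ (NonemptySubsets.map i.castSucc.succAbove s).1 ↔
      Fin.last (n + 1) ∈ s.1 := by
    rw [← hl]
    exact Fin.succAbove_right_injective.mem_finset_image
  by_cases hs : Fin.last (n + 1) ∈ s.1
  · rw [cone_apply_of_mem _ _ _ _ hs]
    exact cone_apply_of_mem d m h _ (h1.2 hs)
  · rw [cone_apply_of_notMem _ _ _ _ hs]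
    refine (cone_apply_of_notMem d m h _ (h1.not.2 hs)).trans ?_
    refine congrArg d.toHom (Subtype.ext (Finset.ext fun j => ?_))
    refine mem_restrict.trans (Finset.mem_image.trans (Iff.trans ?_ Finset.mem_image.symm))
    constructor
    · rintro ⟨k, hk, hkj⟩
      induction k using Fin.lastCases with
      | last => exact absurd hk hs
      | cast k =>
        rw [Fin.castSucc_succAbove_castSucc] at hkj
        exact ⟨k, mem_restrict.2 hk, Fin.castSucc_injective _ hkj⟩
    · rintro ⟨k, hk, rfl⟩
      exact ⟨k.castSucc, mem_restrict.1 hk, Fin.castSucc_succAbove_castSucc⟩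

theorem zero_ext {a b : Simplex K 0} (h : a.support = b.support) : a = b :=
  zeroEquiv.injective h

/-- The `1`-simplex from `a` to `b` with support `b`, where `a ≤ b`. -/
noncomputable def edge (a b : Simplex K 0) (h : a.support ≤ b.support) : Simplex K 1 :=
  a.cone b.support h

theorem support_edge (a b : Simplex K 0) (h : a.support ≤ b.support) :
    (edge a b h).support = b.support :=
  support_cone _ _ _

theorem face_one_edge (a b : Simplex K 0) (h : a.support ≤ b.support) :
    (edge a b h).face 1 = a :=
  face_last_cone _ _ _

theorem face_zero_edge (a b : Simplex K 0) (h : a.support ≤ b.support) :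
    (edge a b h).face 0 = b := by
  apply zero_ext
  refine cone_apply_of_mem a b.support h
    (NonemptySubsets.map (Fin.succAbove 0) ⟨Finset.univ, Finset.univ_nonempty⟩) (by decide)

theorem face_one_face_one (c : Simplex K 2) : (c.face 1).face 1 = (c.face 2).face 1 := by
  unfold face
  rw [pull_pull, pull_pull]
  exact pull_congr (by decide) c

theorem face_two_face_zero (c : Simplex K 2) : (c.face 2).face 0 = (c.face 0).face 1 := by
  unfold face
  rw [pull_pull, pull_pull]
  exact pull_congr (by decide) c

theorem face_one_face_zero (c : Simplex K 2) : (c.face 1).face 0 = (c.face 0).face 0 := by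
  unfold face
  rw [pull_pull, pull_pull]
  exact pull_congr (by decide) c

theorem reverse_reverse (b : Simplex K 1) : b.reverse.reverse = b := by
  unfold reverse
  rw [pull_pull]
  exact pull_eq_self _ (by decide) b

end Simplex

/-! ### Path homotopy laws and the values of cocycles on paths. -/

namespace SPath

variable {K : Type u} [PartialOrder K] {a₀ a₁ : Simplex K 0}

/-- A `1`-simplex as a path of length one between its vertices. -/
def ofSimplex (b : Simplex K 1) (h₁ : b.face 1 = a₀) (h₀ : b.face 0 = a₁) : SPath a₀ a₁ where
  simplices := [b]
  ne_nil := by simp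
  source := h₁
  chain := by simp
  target := h₀

theorem reverse_reverse (p : SPath a₀ a₁) : p.reverse.reverse = p := by
  ext1
  have h : Simplex.reverse ∘ Simplex.reverse = (id : Simplex K 1 → Simplex K 1) :=
    funext Simplex.reverse_reverse
  simp [reverse, h]

theorem comp_reverse (p : SPath a₀ a₁) : Homotopic (p.comp p.reverse) (const a₁) := by
  have h := reverse_comp p.reverse
  rwa [reverse_reverse] at h

theorem comp_reverse_comp {a₂ : Simplex K 0} (p : SPath a₀ a₁) (q : SPath a₂ a₁) :
    Homotopic (p.comp (p.reverse.comp q)) q := by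
  rw [← comp_assoc]
  exact .trans _ _ _ (Homotopic.comp_right (comp_reverse p) q) (const_comp q)

/-- The right unit law follows formally from the left one and inverses: the constant path is
replaced by `p̄ * p`, and then `p * p̄` cancels. -/
theorem comp_const (p : SPath a₀ a₁) : Homotopic (p.comp (const a₀)) p :=
  .trans _ _ _ (Homotopic.comp_left p (.symm _ _ (reverse_comp p))) (comp_reverse_comp p p)

/-- Induction along the `1`-simplices of a path. -/
theorem simplices_induction {P : Simplex K 0 → List (Simplex K 1) → Prop} (nil : P a₀ [])
    (cons : ∀ b l, P (b.face 1) l → P (b.face 0) (b :: l)) (p : SPath a₀ a₁) :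
    P a₁ p.simplices := by
  obtain ⟨l, hl, hs, hc, ht⟩ := p
  induction l generalizing a₁ with
  | nil => exact absurd rfl hl
  | cons b l ih =>
    cases l with
    | nil =>
      simp only [List.getLast_singleton] at hs
      simp only [List.head_cons] at ht
      subst hs ht
      exact cons b [] nil
    | cons b' l =>
      simp only [List.head_cons] at ht
      subst ht
      rw [List.isChain_cons_cons] at hc
      exact cons b _ (ih (a₁ := b.face 1) (by simp) (by simpa using hs) hc.2 hc.1)

end SPath

namespace OneCochain

variable {K : Type u} [PartialOrder K] {G : Type v} [Group G] {z : OneCochain K G}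
  {a₀ a₁ a₂ : Simplex K 0}

theorem onPath_comp (z : OneCochain K G) (q : SPath a₁ a₂) (p : SPath a₀ a₁) :
    z.onPath (q.comp p) = z.onPath q * z.onPath p := by
  simp [onPath, SPath.comp]

theorem onPath_ofSimplex (z : OneCochain K G) (b : Simplex K 1) (h₁ : b.face 1 = a₀)
    (h₀ : b.face 0 = a₁) : z.onPath (SPath.ofSimplex b h₁ h₀) = z.toFun b := by
  simp [onPath, SPath.ofSimplex]

namespace IsCocycle

theorem onPath_eq (hz : IsCocycle z) {p q : SPath a₀ a₁} (h : SPath.Homotopic p q) :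
    z.onPath p = z.onPath q := by
  induction h with
  | rel p q h =>
    obtain ⟨l, r, c, hp, hq⟩ := h
    simp [onPath, hp, hq, ← hz c, mul_assoc]
  | refl _ => rfl
  | symm _ _ _ ih => exact ih.symm
  | trans _ _ _ _ _ ih₁ ih₂ => exact ih₁.trans ih₂

theorem onPath_const (hz : IsCocycle z) (a : Simplex K 0) : z.onPath (SPath.const a) = 1 := by
  have h := hz.onPath_eq (SPath.const_comp (SPath.const a))
  rw [onPath_comp] at h
  exact mul_eq_left.1 h

theorem onPath_reverse (hz : IsCocycle z) (p : SPath a₀ a₁) :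
    z.onPath p.reverse = (z.onPath p)⁻¹ := by
  have h := hz.onPath_eq (SPath.reverse_comp p)
  rw [onPath_comp, hz.onPath_const] at h
  exact eq_inv_of_mul_eq_one_left h

/-- The homomorphism `[p] ↦ z(p)` on the first homotopy group. -/
def toMonoidHom (hz : IsCocycle z) (a₀ : Simplex K 0) : HomotopyGroup a₀ →* G where
  toFun := Quotient.lift z.onPath fun _ _ h => hz.onPath_eq h
  map_one' := hz.onPath_const a₀
  map_mul' := by
    rintro ⟨p⟩ ⟨q⟩
    exact z.onPath_comp p q

theorem toMonoidHom_mk (hz : IsCocycle z) (p : SPath a₀ a₀) :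
    hz.toMonoidHom a₀ (HomotopyGroup.mk p) = z.onPath p := rfl

/-- This is the cocycle identity for the cone over `b` with apex `a`: its face 2 is `b`, and its
faces 0 and 1 are the edges from the vertices of `b` to the apex. -/
theorem cone_edge (hz : IsCocycle z) (b : Simplex K 1) (a : Simplex K 0)
    (h : b.support ≤ a.support) :
    z.toFun (Simplex.edge (b.face 0) a ((b.support_face_le 0).trans h)) * z.toFun b =
      z.toFun (Simplex.edge (b.face 1) a ((b.support_face_le 1).trans h)) := by
  have h₀ := Simplex.face_castSucc_cone b a.support h 0
  have h₁ := Simplex.face_castSucc_cone b a.support h 1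
  have h₂ := Simplex.face_last_cone b a.support h
  have hc := hz (b.cone a.support h)
  exact (congrArg₂ (fun x y => z.toFun x * z.toFun y) h₀ h₂).symm.trans
    (hc.trans (congrArg z.toFun h₁))

end IsCocycle

end OneCochain

/-! ### Homomorphisms of the first homotopy group and cocycles -/

section Equivalence

variable {K : Type u} [PartialOrder K] {G : Type v} [Group G] {a₀ : Simplex K 0}

variable (w : ∀ a, SPath a₀ a)

/-- The loop obtained from a `1`-simplex by joining its vertices to the base point. -/
def simplexLoop (b : Simplex K 1) : SPath a₀ a₀ :=
  (w (b.face 0)).reverse.comp ((SPath.single b).comp (w (b.face 1)))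

/-- The universal `1`-cocycle, with values in the first homotopy group. -/
def universalCochain : OneCochain K (HomotopyGroup a₀) :=
  ⟨fun b => HomotopyGroup.mk (simplexLoop w b)⟩

/-- The product telescopes: between consecutive 1-simplices a factor `w a * w̄ a` cancels, leaving
only the closing paths at the two ends, and the one at `a₀` is null-homotopic. -/
theorem universalCochain_onPath_of_base (hw : (w a₀).Homotopic (SPath.const a₀))
    {a : Simplex K 0} (p : SPath a₀ a) :
    (universalCochain w).onPath p = HomotopyGroup.mk ((w a).reverse.comp p) := by
  -- The induction starts at the empty list, which is not a path; prepending the constant path at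
  -- `a₀`, last in the list, makes every stage a path.
  suffices H : ∃ q : SPath a₀ a, q.simplices = p.simplices ++ [a₀.degen 0] ∧
      (universalCochain w).onPath p = HomotopyGroup.mk ((w a).reverse.comp q) by
    obtain ⟨q, hq, h⟩ := H
    refine h.trans ((HomotopyGroup.mk_eq_mk _ _).2 (SPath.Homotopic.comp_left _ ?_))
    have e : q = p.comp (SPath.const a₀) := SPath.ext hq
    rw [e]
    exact SPath.comp_const p
  refine SPath.simplices_induction
    (P := fun a l => ∃ q : SPath a₀ a, q.simplices = l ++ [a₀.degen 0] ∧
      (l.map (universalCochain w).toFun).prod = HomotopyGroup.mk ((w a).reverse.comp q))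
    ⟨SPath.const a₀, rfl, ?_⟩ ?_ p
  · exact ((HomotopyGroup.mk_eq_mk _ _).2 (.trans _ _ _
      (SPath.Homotopic.comp_left _ (.symm _ _ hw)) (SPath.reverse_comp (w a₀)))).symm
  · rintro b l ⟨q, hq, h⟩
    refine ⟨(SPath.single b).comp q, by simp [SPath.comp, SPath.single, hq], ?_⟩
    rw [List.map_cons, List.prod_cons, h]
    change HomotopyGroup.mk (((w _).reverse.comp ((SPath.single b).comp (w _))).comp
      ((w _).reverse.comp q)) = _
    rw [SPath.comp_assoc, SPath.comp_assoc, HomotopyGroup.mk_eq_mk]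
    exact SPath.Homotopic.comp_left _ (SPath.Homotopic.comp_left _ (SPath.comp_reverse_comp _ _))

theorem universalCochain_onPath (hw : (w a₀).Homotopic (SPath.const a₀))
    {a a' : Simplex K 0} (p : SPath a a') :
    (universalCochain w).onPath p = HomotopyGroup.mk ((w a').reverse.comp (p.comp (w a))) := by
  rw [← universalCochain_onPath_of_base w hw, OneCochain.onPath_comp,
    universalCochain_onPath_of_base w hw (w a),
    (HomotopyGroup.mk_eq_mk _ _).2 (SPath.reverse_comp (w a)), ← HomotopyGroup.one_eq, mul_one]

theorem universalCochain_onPath_loop (hw : (w a₀).Homotopic (SPath.const a₀))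
    (p : SPath a₀ a₀) : (universalCochain w).onPath p = HomotopyGroup.mk p := by
  rw [universalCochain_onPath_of_base w hw, ← HomotopyGroup.mk_mul_mk, ← HomotopyGroup.inv_mk,
    (HomotopyGroup.mk_eq_mk _ _).2 hw, ← HomotopyGroup.one_eq, inv_one, one_mul]

/-- By the telescoped formula the value on a path depends only on its homotopy class, and the faces
of `c` form two paths related by one elementary deformation. -/
theorem universalCochain_isCocycle (hw : (w a₀).Homotopic (SPath.const a₀)) :
    OneCochain.IsCocycle (universalCochain w) := by
  intro c
  have h : SPath.Homotopic (SPath.ofSimplex (c.face 1) c.face_one_face_one c.face_one_face_zero)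
      ((SPath.ofSimplex (c.face 0) rfl rfl).comp (SPath.ofSimplex (c.face 2) rfl c.face_two_face_zero)) :=
    .rel _ _ ⟨[], [], c, rfl, rfl⟩
  rw [← OneCochain.onPath_ofSimplex _ (c.face 0) rfl rfl,
    ← OneCochain.onPath_ofSimplex _ (c.face 2) rfl c.face_two_face_zero,
    ← OneCochain.onPath_ofSimplex _ (c.face 1) c.face_one_face_one c.face_one_face_zero, ← OneCochain.onPath_comp,
    universalCochain_onPath w hw, universalCochain_onPath w hw, HomotopyGroup.mk_eq_mk]
  exact SPath.Homotopic.comp_left _ (SPath.Homotopic.comp_right (.symm _ _ h) _)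

/-- The cochain obtained by applying a homomorphism to the values. -/
def OneCochain.map {H : Type w} [Group H] (f : G →* H) (z : OneCochain K G) : OneCochain K H :=
  ⟨fun b => f (z.toFun b)⟩

theorem OneCochain.map_onPath {H : Type w} [Group H] (f : G →* H) (z : OneCochain K G)
    {a₁ a₂ : Simplex K 0} (p : SPath a₁ a₂) : (z.map f).onPath p = f (z.onPath p) := by
  simp [OneCochain.onPath, OneCochain.map, map_list_prod, Function.comp_def]

theorem OneCochain.IsCocycle.map {H : Type w} [Group H] (f : G →* H) {z : OneCochain K G}
    (hz : OneCochain.IsCocycle z) : OneCochain.IsCocycle (z.map f) := by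
  intro c
  simp only [OneCochain.map, ← map_mul, hz c]

/-- The functor that sends a homomorphism `σ` on the first homotopy group to the cocycle
obtained by applying `σ` to the universal cocycle. -/
def homToCocycle (hw : (w a₀).Homotopic (SPath.const a₀)) :
    HomCat (HomotopyGroup a₀) G ⥤ OneCocycle K G where
  obj σ := ⟨(universalCochain w).map σ.hom, (universalCochain_isCocycle w hw).map σ.hom⟩
  map {σ₁ σ} h := ObjectProperty.homMk ⟨fun _ => h.val, fun a₀ a₁ p => by
    rw [OneCochain.map_onPath, OneCochain.map_onPath]
    exact h.comm _⟩
  map_id _ := rfl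
  map_comp _ _ := rfl

/-- A morphism of cocycles is determined by its value at `a₀`, since naturality along `w a`
transports that value to every `a`. -/
theorem homToCocycle_isEquivalence (hw : (w a₀).Homotopic (SPath.const a₀)) :
    (homToCocycle (G := G) w hw).IsEquivalence where
  faithful := ⟨fun {σ₁ σ f g} h => HomCat.Hom.ext
    (congrFun (congrArg (fun k => OneCochain.Hom.toFun k.hom) h) a₀)⟩
  full := ⟨fun {σ₁ σ} f => by
    obtain ⟨f⟩ := f
    refine ⟨⟨f.toFun a₀, ?_⟩, ?_⟩
    · rintro ⟨p⟩
      have h := f.comm a₀ a₀ p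
      erw [OneCochain.map_onPath, OneCochain.map_onPath,
        universalCochain_onPath_loop w hw] at h
      exact h
    · apply ObjectProperty.hom_ext
      apply OneCochain.Hom.ext
      funext a
      -- The universal cocycle is trivial on `w a`, so naturality there forces `f` to be constant.
      have h := f.comm a₀ a (w a)
      erw [OneCochain.map_onPath, OneCochain.map_onPath,
        universalCochain_onPath_of_base w hw, (HomotopyGroup.mk_eq_mk _ _).2
          (SPath.reverse_comp (w a)), ← HomotopyGroup.one_eq, map_one, map_one, mul_one,
        one_mul] at h
      exact h.symm⟩
  essSurj := ⟨fun z => ⟨⟨z.property.toMonoidHom a₀⟩, ⟨by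
    have h : ∀ {a a' : Simplex K 0} (p : SPath a a'),
        ((universalCochain w).map (z.property.toMonoidHom a₀)).onPath p =
          (z.obj.onPath (w a'))⁻¹ * (z.obj.onPath p * z.obj.onPath (w a)) := by
      intro a a' p
      rw [OneCochain.map_onPath, universalCochain_onPath w hw,
        OneCochain.IsCocycle.toMonoidHom_mk, OneCochain.onPath_comp, OneCochain.onPath_comp,
        z.property.onPath_reverse]
    -- The value `z(w a)` undoes the closing up of simplices at the vertex `a`.
    refine ObjectProperty.isoMk _
      { hom := ⟨fun a => z.obj.onPath (w a), fun a a' p => ?_⟩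
        inv := ⟨fun a => (z.obj.onPath (w a))⁻¹, fun a a' p => ?_⟩
        hom_inv_id := OneCochain.Hom.ext (funext fun a => inv_mul_cancel _)
        inv_hom_id := OneCochain.Hom.ext (funext fun a => mul_inv_cancel _) }
    · exact (congrArg _ (h p)).trans (mul_inv_cancel_left _ _)
    · refine Eq.trans ?_ (congrArg (· * _) (h p)).symm
      simp [mul_assoc]⟩⟩⟩

/-- Isomorphic groups have equivalent categories of homomorphisms. -/
def HomCat.congr {S : Type u} {T : Type w} [Group S] [Group T] (e : S ≃* T) :
    HomCat S G ≌ HomCat T G where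
  functor :=
    { obj := fun σ => ⟨σ.hom.comp e.symm.toMonoidHom⟩
      map := fun h => ⟨h.val, fun g => h.comm (e.symm g)⟩
      map_id := fun _ => rfl
      map_comp := fun _ _ => rfl }
  inverse :=
    { obj := fun σ => ⟨σ.hom.comp e.toMonoidHom⟩
      map := fun h => ⟨h.val, fun g => h.comm (e g)⟩
      map_id := fun _ => rfl
      map_comp := fun _ _ => rfl }
  unitIso := NatIso.ofComponents
    (fun σ =>
      { hom := ⟨1, fun g => by simp⟩
        inv := ⟨1, fun g => by simp⟩
        hom_inv_id := HomCat.Hom.ext (mul_one _)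
        inv_hom_id := HomCat.Hom.ext (mul_one _) })
    (fun f => HomCat.Hom.ext ((one_mul _).trans (mul_one _).symm))
  counitIso := NatIso.ofComponents
    (fun σ =>
      { hom := ⟨1, fun g => by simp⟩
        inv := ⟨1, fun g => by simp⟩
        hom_inv_id := HomCat.Hom.ext (mul_one _)
        inv_hom_id := HomCat.Hom.ext (mul_one _) })
    (fun f => HomCat.Hom.ext ((one_mul _).trans (mul_one _).symm))
  functor_unitIso_comp _ := HomCat.Hom.ext (mul_one _)

end Equivalence

/-! ### Connectedness of a base as a poset. -/

section Topology

open scoped unitInterval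

variable {M : Type u} [TopologicalSpace M] {K : Set (Set M)} {x₀ : M} {a₀ : Simplex K 0}

theorem SPath.nonempty_of_le_of_le {K : Type u} [PartialOrder K] {m a b : Simplex K 0}
    (ha : m.support ≤ a.support) (hb : m.support ≤ b.support) : Nonempty (SPath a b) :=
  ⟨(ofSimplex _ (Simplex.face_one_edge m b hb) (Simplex.face_zero_edge m b hb)).comp
    (ofSimplex _ (Simplex.face_one_edge m a ha) (Simplex.face_zero_edge m a ha)).reverse⟩

theorem exists_le_le_of_mem (hK : TopologicalSpace.IsTopologicalBasis K) {x : M}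
    {a b : Simplex K 0} (ha : x ∈ (a.support : Set M)) (hb : x ∈ (b.support : Set M)) :
    ∃ m : Simplex K 0, x ∈ (m.support : Set M) ∧ m.support ≤ a.support ∧
      m.support ≤ b.support := by
  obtain ⟨m, hm, hx, h⟩ := hK.exists_subset_inter _ a.support.2 _ b.support.2 x ⟨ha, hb⟩
  exact ⟨Simplex.zeroEquiv.symm ⟨m, hm⟩, hx, h.trans Set.inter_subset_left,
    h.trans Set.inter_subset_right⟩

theorem exists_mem_support (hK : TopologicalSpace.IsTopologicalBasis K) (x : M) :
    ∃ a : Simplex K 0, x ∈ (a.support : Set M) := by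
  obtain ⟨m, hm, hx, -⟩ := hK.exists_subset_of_mem_open (Set.mem_univ x) isOpen_univ
  exact ⟨Simplex.zeroEquiv.symm ⟨m, hm⟩, hx⟩

/-- A base of nonempty open subsets of a connected space is connected as a poset. -/
theorem nonempty_sPath [PreconnectedSpace M] (hK : TopologicalSpace.IsTopologicalBasis K)
    (hne : ∀ a : Simplex K 0, (a.support : Set M).Nonempty) (a b : Simplex K 0) :
    Nonempty (SPath a b) := by
  have hlink : ∀ {x : M} {b c : Simplex K 0}, x ∈ (b.support : Set M) →
      x ∈ (c.support : Set M) → Nonempty (SPath a b) → Nonempty (SPath a c) := by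
    rintro x b c hb hc ⟨p⟩
    obtain ⟨m, -, hmb, hmc⟩ := exists_le_le_of_mem hK hb hc
    obtain ⟨q⟩ := SPath.nonempty_of_le_of_le hmb hmc
    exact ⟨q.comp p⟩
  -- By `hlink`, reaching one member of the base around `x` is the same as reaching all of them;
  -- this makes both `S` and its complement open.
  let S : Set M := {x | ∀ b : Simplex K 0, x ∈ (b.support : Set M) → Nonempty (SPath a b)}
  have hS : IsClopen S := by
    constructor
    · rw [← isOpen_compl_iff, isOpen_iff_forall_mem_open]
      intro x hx
      obtain ⟨b, hb, hab⟩ : ∃ b : Simplex K 0, x ∈ (b.support : Set M) ∧ ¬ Nonempty (SPath a b) := by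
        simpa [S] using hx
      exact ⟨b.support, fun y hy h => hab (h b hy), hK.isOpen b.support.2, hb⟩
    · rw [isOpen_iff_forall_mem_open]
      intro x hx
      obtain ⟨b, hb⟩ := exists_mem_support hK x
      exact ⟨b.support, fun y hy c hc => hlink hy hc (hx b hb), hK.isOpen b.support.2, hb⟩
  obtain ⟨x, hx⟩ := hne a
  have hxS : x ∈ S := fun b hb => hlink hx hb ⟨SPath.const a⟩
  obtain ⟨y, hy⟩ := hne b
  have hyS : y ∈ S := by
    rw [hS.eq_univ ⟨x, hxS⟩]
    trivial
  exact hyS b hy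

/-! ### The cocycle with values in the fundamental group -/

/-- Both paths lift to the subspace `U`, where they are homotopic; the inclusion carries the
homotopy to the whole space. -/
theorem mk_eq_mk_of_isSimplyConnected {U : Set M} (hU : IsSimplyConnected U) {x y : M}
    (γ γ' : Path x y) (h : ∀ t, γ t ∈ U) (h' : ∀ t, γ' t ∈ U) :
    Path.Homotopic.Quotient.mk γ = Path.Homotopic.Quotient.mk γ' := by
  have := hU.simplyConnectedSpace
  have hx : x ∈ U := γ.source ▸ h 0
  have hy : y ∈ U := γ.target ▸ h 1
  let δ : Path (⟨x, hx⟩ : U) ⟨y, hy⟩ :=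
    ⟨⟨fun t => ⟨γ t, h t⟩, by fun_prop⟩, by simp, by simp⟩
  let δ' : Path (⟨x, hx⟩ : U) ⟨y, hy⟩ :=
    ⟨⟨fun t => ⟨γ' t, h' t⟩, by fun_prop⟩, by simp, by simp⟩
  exact Path.Homotopic.Quotient.eq.2
    ((SimplyConnectedSpace.paths_homotopic δ δ').map ⟨Subtype.val, continuous_subtype_val⟩)

/-- The class of the paths from `x` to `y` that stay in the path connected set `U`. -/
noncomputable def segmentClass {U : Set M} (hU : IsSimplyConnected U) {x y : M} (hx : x ∈ U)
    (hy : y ∈ U) : Path.Homotopic.Quotient x y :=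
  .mk (hU.isPathConnected.joinedIn x hx y hy).somePath

section segmentClass

variable {U V : Set M} (hU : IsSimplyConnected U) (hV : IsSimplyConnected V) {x y z : M}

theorem mk_eq_segmentClass (γ : Path x y) (h : ∀ t, γ t ∈ U) (hx : x ∈ U) (hy : y ∈ U) :
    .mk γ = segmentClass hU hx hy :=
  mk_eq_mk_of_isSimplyConnected hU _ _ h
    (hU.isPathConnected.joinedIn x hx y hy).somePath_mem

theorem segmentClass_self (hx : x ∈ U) : segmentClass hU hx hx = .refl x :=
  (mk_eq_segmentClass hU (Path.refl x) (fun _ => hx) hx hx).symm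

theorem segmentClass_trans (hx : x ∈ U) (hy : y ∈ U) (hz : z ∈ U) :
    (segmentClass hU hx hy).trans (segmentClass hU hy hz) = segmentClass hU hx hz := by
  refine mk_eq_segmentClass hU ((hU.isPathConnected.joinedIn x hx y hy).somePath.trans
    (hU.isPathConnected.joinedIn y hy z hz).somePath) (fun t => ?_) hx hz
  rw [Path.trans_apply]
  split_ifs
  · exact (hU.isPathConnected.joinedIn x hx y hy).somePath_mem _
  · exact (hU.isPathConnected.joinedIn y hy z hz).somePath_mem _

theorem segmentClass_mono (h : U ⊆ V) (hx : x ∈ U) (hy : y ∈ U) :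
    segmentClass hU hx hy = segmentClass hV (h hx) (h hy) :=
  mk_eq_segmentClass hV _
    (fun t => h ((hU.isPathConnected.joinedIn x hx y hy).somePath_mem t)) _ _

end segmentClass

/-- The loop obtained from a path by joining its end points to the base point. -/
noncomputable def closeUp (w : ∀ x, Path.Homotopic.Quotient x₀ x) {x y : M} (f : Path.Homotopic.Quotient x y) :
    FundamentalGroup M x₀ :=
  ((w x).trans f).trans (w y).symm

section closeUp

variable (w : ∀ x, Path.Homotopic.Quotient x₀ x) {x y z : M}

theorem closeUp_trans_path (f : Path.Homotopic.Quotient x y) :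
    Path.Homotopic.Quotient.trans (closeUp w f) (w y) = (w x).trans f := by
  unfold closeUp
  rw [Path.Homotopic.Quotient.trans_assoc, Path.Homotopic.Quotient.symm_trans,
    Path.Homotopic.Quotient.trans_refl]

/-- The closing paths at `y` cancel. The factors appear in reverse order because the product in the
fundamental group travels its right factor first, as the product in π₁(K, a₀) does. -/
theorem closeUp_trans (f : Path.Homotopic.Quotient x y) (g : Path.Homotopic.Quotient y z) :
    closeUp w (f.trans g) = closeUp w g * closeUp w f := by
  rw [FundamentalGroup.mul_def]
  change _ = Path.Homotopic.Quotient.trans (closeUp w f) (((w y).trans g).trans (w z).symm)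
  rw [← Path.Homotopic.Quotient.trans_assoc, ← Path.Homotopic.Quotient.trans_assoc,
    closeUp_trans_path, Path.Homotopic.Quotient.trans_assoc (w x) f g]
  rfl

theorem closeUp_refl (x : M) : closeUp w (.refl x) = 1 := by
  rw [FundamentalGroup.one_def]
  unfold closeUp
  rw [Path.Homotopic.Quotient.trans_refl, Path.Homotopic.Quotient.trans_symm]

theorem closeUp_base (hw : w x₀ = .refl x₀) (f : Path.Homotopic.Quotient x₀ x₀) :
    closeUp w f = f := by
  have h := closeUp_trans_path w f
  rwa [hw, Path.Homotopic.Quotient.trans_refl, Path.Homotopic.Quotient.refl_trans] at h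

end closeUp

/-- A choice of a point in each member of the base and of a path to each point of the space. -/
structure BasePoints (K : Set (Set M)) (x₀ : M) (a₀ : Simplex K 0) where
  path : ∀ x, Path.Homotopic.Quotient x₀ x
  path_base : path x₀ = .refl x₀
  point : Simplex K 0 → M
  point_mem : ∀ a, point a ∈ (a.support : Set M)
  point_base : point a₀ = x₀

theorem BasePoints.nonempty [PathConnectedSpace M]
    (hne : ∀ a : Simplex K 0, (a.support : Set M).Nonempty) (hx₀ : x₀ ∈ (a₀.support : Set M)) :
    Nonempty (BasePoints K x₀ a₀) := by
  classical
  choose pt hpt using hne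
  refine ⟨⟨fun x => if h : x₀ = x then h ▸ .refl x₀ else
    .mk (PathConnectedSpace.somePath x₀ x), by simp, fun a => if a = a₀ then x₀ else pt a,
    fun a => ?_, by simp⟩⟩
  split_ifs with h
  · exact h ▸ hx₀
  · exact hpt a

namespace BasePoints

variable (B : BasePoints K x₀ a₀) (hsc : ∀ U : K, IsSimplyConnected (U : Set M))

/-- The loop that runs inside `U` from `x` to `y`. -/
noncomputable def loop (U : K) {x y : M} (hx : x ∈ (U : Set M)) (hy : y ∈ (U : Set M)) :
    FundamentalGroup M x₀ :=
  closeUp B.path (segmentClass (hsc U) hx hy)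

theorem loop_mul_loop (U : K) {x y z : M} (hx : x ∈ (U : Set M)) (hy : y ∈ (U : Set M))
    (hz : z ∈ (U : Set M)) : B.loop hsc U hy hz * B.loop hsc U hx hy = B.loop hsc U hx hz := by
  unfold loop
  rw [← closeUp_trans, segmentClass_trans]

theorem loop_self (U : K) {x y : M} (hx : x ∈ (U : Set M)) (hy : y ∈ (U : Set M)) (h : x = y) :
    B.loop hsc U hx hy = 1 := by
  subst h
  unfold loop
  rw [segmentClass_self, closeUp_refl]

theorem loop_mono {U V : K} (h : U ≤ V) {x y : M} (hx : x ∈ (U : Set M)) (hy : y ∈ (U : Set M)) :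
    B.loop hsc U hx hy = B.loop hsc V (h hx) (h hy) := by
  unfold loop
  rw [segmentClass_mono (hsc U) (hsc V) h]

/-- The `1`-cochain that sends a `1`-simplex `b` to the loop that runs inside `|b|` from the point
of `∂₁ b` to the point of `∂₀ b`. -/
noncomputable def cochain : OneCochain K (FundamentalGroup M x₀) :=
  ⟨fun b => B.loop hsc b.support (b.support_face_le 1 (B.point_mem (b.face 1)))
    (b.support_face_le 0 (B.point_mem (b.face 0)))⟩

/-- Iterated faces agree only propositionally and occur in the membership proofs, so support and
vertices are exchanged together. -/
theorem loop_congr {U V : K} (h : U = V) {a a' b b' : Simplex K 0} (ha : a = a') (hb : b = b')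
    (h₁ : B.point a ∈ (U : Set M)) (h₂ : B.point b ∈ (U : Set M))
    (h₁' : B.point a' ∈ (V : Set M)) (h₂' : B.point b' ∈ (V : Set M)) :
    B.loop hsc U h₁ h₂ = B.loop hsc V h₁' h₂' := by
  subst h ha hb
  rfl

/-- All three loops may be run inside the simply connected set |c|, where only the endpoints matter.
-/
theorem cochain_isCocycle : (B.cochain hsc).IsCocycle := by
  intro c
  have hv : ∀ i j, B.point ((c.face i).face j) ∈ (c.support : Set M) := fun i j =>
    c.support_face_le i ((c.face i).support_face_le j (B.point_mem _))
  have h : ∀ i, (B.cochain hsc).toFun (c.face i) =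
      B.loop hsc c.support (hv i 1) (hv i 0) := fun i =>
    B.loop_mono hsc (c.support_face_le i) _ _
  rw [h, h, h, B.loop_congr hsc rfl c.face_one_face_one c.face_one_face_zero _ _ (hv 2 1) (hv 0 0),
    B.loop_congr hsc rfl rfl c.face_two_face_zero (hv 2 1) (hv 2 0) (hv 2 1) (hv 0 1), loop_mul_loop]

theorem cochain_edge (a b : Simplex K 0) (h : a.support ≤ b.support) :
    (B.cochain hsc).toFun (Simplex.edge a b h) =
      B.loop hsc b.support (h (B.point_mem a)) (B.point_mem b) :=
  B.loop_congr hsc (Simplex.support_edge a b h) (Simplex.face_one_edge a b h)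
    (Simplex.face_zero_edge a b h) _ _ _ _

/-- This changes the member of the base around `x` without changing the loop. The new path passes
from `a` to `b` through some `m ⊆ a ∩ b` containing `x`; the detours to the point of `m` stay in `a`
and in `b`, so they are absorbed there. -/
theorem exists_path_loop_eq (hK : TopologicalSpace.IsTopologicalBasis K) {a b : Simplex K 0}
    {x : M} (ha : x ∈ (a.support : Set M)) (hb : x ∈ (b.support : Set M)) (p : SPath a₀ a) :
    ∃ q : SPath a₀ b, B.loop hsc b.support (B.point_mem b) hb * (B.cochain hsc).onPath q =
      B.loop hsc a.support (B.point_mem a) ha * (B.cochain hsc).onPath p := by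
  obtain ⟨m, hx, hma, hmb⟩ := exists_le_le_of_mem hK ha hb
  refine ⟨(SPath.ofSimplex _ (Simplex.face_one_edge m b hmb) (Simplex.face_zero_edge m b hmb)).comp
    ((SPath.ofSimplex _ (Simplex.face_one_edge m a hma)
      (Simplex.face_zero_edge m a hma)).reverse.comp p), ?_⟩
  rw [OneCochain.onPath_comp, OneCochain.onPath_comp, (B.cochain_isCocycle hsc).onPath_reverse,
    OneCochain.onPath_ofSimplex, OneCochain.onPath_ofSimplex, cochain_edge, cochain_edge,
    ← mul_assoc, ← mul_assoc, loop_mul_loop, ← B.loop_mono hsc hmb (B.point_mem m) hx]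
  congr 1
  rw [mul_inv_eq_iff_eq_mul, loop_mul_loop, ← B.loop_mono hsc hma (B.point_mem m) hx]

end BasePoints

/-- A property of homotopy classes of paths holds for all classes if it is stable under
composition and holds for the classes of paths that stay in a member of a given open cover. -/
theorem quotient_induction_of_isOpenCover {ι : Type w} {U : ι → Set M} (hU : ∀ i, IsOpen (U i))
    (hc : ∀ x, ∃ i, x ∈ U i) {P : ∀ {x y : M}, Path.Homotopic.Quotient x y → Prop}
    (small : ∀ (i : ι) {x y : M} (γ : Path x y), (∀ t, γ t ∈ U i) →
      P (Path.Homotopic.Quotient.mk γ))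
    (trans : ∀ {x y z : M} (f : Path.Homotopic.Quotient x y) (g : Path.Homotopic.Quotient y z),
      P f → P g → P (f.trans g))
    {x y : M} (f : Path.Homotopic.Quotient x y) : P f := by
  induction f with
  | mk γ =>
  -- Lebesgue number argument: each subinterval of the partition is mapped into one member of the
  -- cover.
  obtain ⟨t, t_0, t_mono, ⟨n_max, h_max⟩, t_sub⟩ :=
    exists_monotone_Icc_subset_open_cover_unitInterval
      (fun i => (hU i).preimage γ.continuous) fun t _ => Set.mem_iUnion.2 (hc (γ t))
  have key : ∀ n, P (Path.Homotopic.Quotient.mk (γ.subpath (t 0) (t n))) := by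
    intro n
    induction n with
    | zero =>
      obtain ⟨i, hi⟩ := hc (γ (t 0))
      refine small i _ fun s => ?_
      rw [Path.subpath_self]
      exact hi
    | succ n ih =>
      obtain ⟨i, hi⟩ := t_sub n
      have h := trans _ _ ih (small i (γ.subpath (t n) (t (n + 1))) fun s => ?_)
      · rwa [← Path.Homotopic.Quotient.mk_trans,
          Path.Homotopic.Quotient.eq.2 ⟨Path.Homotopy.subpathTransSubpath γ _ _ _⟩] at h
      · have hs := Set.mem_range_self (f := γ.subpath (t n) (t (n + 1))) s
        rw [Path.range_subpath_of_le _ _ _ (t_mono n.le_succ)] at hs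
        obtain ⟨r, hr, hrs⟩ := hs
        exact hrs ▸ hi hr
  have h := key n_max
  rw [t_0, h_max n_max le_rfl, Path.subpath_zero_one] at h
  -- The subpath over the whole interval runs between `γ 0` and `γ 1`, which become `x` and `y` only
  -- after substitution.
  obtain ⟨γ, hx, hy⟩ := γ
  subst hx hy
  exact h

/-! ### Surjectivity onto the fundamental group. -/

namespace BasePoints

variable (B : BasePoints K x₀ a₀) (hsc : ∀ U : K, IsSimplyConnected (U : Set M))

theorem toMonoidHom_surjective (hK : TopologicalSpace.IsTopologicalBasis K)
    (hx₀ : x₀ ∈ (a₀.support : Set M)) :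
    Function.Surjective ((B.cochain_isCocycle hsc).toMonoidHom a₀) := by
  intro f
  -- Invariant: the elements "follow `p`, then go inside `a` from its point to `x`" are carried by
  -- `f` to elements of the same form at `y`. Quantifying over all starting pairs makes this stable
  -- under composition.
  have key := quotient_induction_of_isOpenCover (ι := K) (U := Subtype.val)
    (fun U => hK.isOpen U.2)
    (fun x => (exists_mem_support hK x).elim fun a ha => ⟨a.support, ha⟩)
    (P := fun {x y} f => ∀ (a : Simplex K 0) (ha : x ∈ (a.support : Set M)) (p : SPath a₀ a),
      ∃ (b : Simplex K 0) (hb : y ∈ (b.support : Set M)) (q : SPath a₀ b),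
        B.loop hsc b.support (B.point_mem b) hb * (B.cochain hsc).onPath q =
          closeUp B.path f * (B.loop hsc a.support (B.point_mem a) ha *
            (B.cochain hsc).onPath p)) ?_ ?_ (f : Path.Homotopic.Quotient x₀ x₀)
  · obtain ⟨b, hb, q, h⟩ := key a₀ hx₀ (SPath.const a₀)
    obtain ⟨q', h'⟩ := B.exists_path_loop_eq hsc hK hb hx₀ q
    refine ⟨HomotopyGroup.mk q', ?_⟩
    rw [h, (B.cochain_isCocycle hsc).onPath_const, B.loop_self hsc _ _ _ B.point_base,
      closeUp_base _ B.path_base, one_mul, one_mul, mul_one] at h'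
    exact h'
  · intro U x y γ hγ a ha p
    have hx : x ∈ (U : Set M) := γ.source ▸ hγ 0
    have hy : y ∈ (U : Set M) := γ.target ▸ hγ 1
    obtain ⟨q, hq⟩ := B.exists_path_loop_eq hsc hK (b := Simplex.zeroEquiv.symm U) ha hx p
    refine ⟨Simplex.zeroEquiv.symm U, hy, q, ?_⟩
    rw [← hq, mk_eq_segmentClass (hsc U) γ hγ hx hy, ← mul_assoc]
    exact congrArg (· * _) (B.loop_mul_loop hsc U _ hx hy).symm
  · intro x y z f g hf hg a ha p
    obtain ⟨b, hb, q, h⟩ := hf a ha p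
    obtain ⟨c, hc, r, h'⟩ := hg b hb q
    exact ⟨c, hc, r, by rw [h', h, closeUp_trans, mul_assoc]⟩

end BasePoints

end Topology

/-! ### Injectivity: covering spaces glued from cocycles. -/

theorem Simplex.edge_congr {K : Type u} [PartialOrder K] {a a' b b' : Simplex K 0} (ha : a = a')
    (hb : b = b') (h : a.support ≤ b.support) (h' : a'.support ≤ b'.support) :
    edge a b h = edge a' b' h' := by
  subst ha hb
  rfl

theorem OneCochain.IsCocycle.edge_mul_edge {K : Type u} [PartialOrder K] {G : Type v} [Group G]
    {z : OneCochain K G} (hz : z.IsCocycle) {a b c : Simplex K 0} (h : a.support ≤ b.support)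
    (h' : b.support ≤ c.support) :
    z.toFun (Simplex.edge b c h') * z.toFun (Simplex.edge a b h) =
      z.toFun (Simplex.edge a c (h.trans h')) := by
  have H := hz.cone_edge (Simplex.edge a b h) c ((Simplex.support_edge a b h).le.trans h')
  rwa [Simplex.edge_congr (Simplex.face_zero_edge a b h) rfl _ h',
    Simplex.edge_congr (Simplex.face_one_edge a b h) rfl _ (h.trans h')] at H

theorem SPath.exists_basePaths {K : Type u} [PartialOrder K] {a₀ : Simplex K 0}
    (h : ∀ a, Nonempty (SPath a₀ a)) :
    ∃ w : ∀ a, SPath a₀ a, (w a₀).Homotopic (const a₀) :=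
  -- Precomposing with the reverse of the path chosen for `a₀` makes the path at `a₀`
  -- null-homotopic.
  ⟨fun a => (h a).some.comp (h a₀).some.reverse, comp_reverse _⟩

section Covering

open scoped unitInterval

variable {M : Type u} [TopologicalSpace M] {K : Set (Set M)} {x₀ : M} {a₀ : Simplex K 0}
  {Q : Type v} [Group Q] {z : OneCochain K Q}

/-- A family `r x a`, where `x ∈ a`, that is compatible with the values of `z` on edges. -/
def IsCompatibleFamily (z : OneCochain K Q) (r : M → Simplex K 0 → Q) : Prop :=
  ∀ (x : M) (a b : Simplex K 0) (h : a.support ≤ b.support), x ∈ (a.support : Set M) →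
    r x b = z.toFun (Simplex.edge a b h) * r x a

theorem OneCochain.IsCocycle.exists_isCompatibleFamily (hz : z.IsCocycle)
    (hK : TopologicalSpace.IsTopologicalBasis K) :
    ∃ r : M → Simplex K 0 → Q, IsCompatibleFamily z r := by
  classical
  choose N hN using exists_mem_support hK
  -- The value at `x ∈ a` is the transition from the reference member `N x` to `a` through a small
  -- `m` around `x`. Two choices of `m` give the same value by comparison with a common smaller `l`.
  have hm : ∀ (x : M) (a : Simplex K 0), x ∈ (a.support : Set M) → ∃ q : Q,
      ∀ (m : Simplex K 0) (ha : m.support ≤ a.support) (hn : m.support ≤ (N x).support),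
        x ∈ (m.support : Set M) →
          z.toFun (Simplex.edge m a ha) * (z.toFun (Simplex.edge m (N x) hn))⁻¹ = q := by
    intro x a ha
    obtain ⟨m, hx, hma, hmn⟩ := exists_le_le_of_mem hK ha (hN x)
    refine ⟨_, fun m' hma' hmn' hx' => Eq.trans ?_
      (Eq.refl (z.toFun (Simplex.edge m a hma) * (z.toFun (Simplex.edge m (N x) hmn))⁻¹))⟩
    obtain ⟨l, -, hlm, hlm'⟩ := exists_le_le_of_mem hK hx hx'
    rw [mul_inv_eq_iff_eq_mul, ← mul_inv_eq_iff_eq_mul.2 (hz.edge_mul_edge hlm' hma').symm,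
      ← mul_inv_eq_iff_eq_mul.2 (hz.edge_mul_edge hlm hma).symm,
      ← mul_inv_eq_iff_eq_mul.2 (hz.edge_mul_edge hlm' hmn').symm,
      ← mul_inv_eq_iff_eq_mul.2 (hz.edge_mul_edge hlm hmn).symm]
    group
  choose! r hr using hm
  refine ⟨r, fun x a b h hx => ?_⟩
  obtain ⟨m, hxm, hma, hmn⟩ := exists_le_le_of_mem hK hx (hN x)
  rw [← hr x a hx m hma hmn hxm, ← hr x b (h hx) m (hma.trans h) hmn hxm, ← mul_assoc,
    hz.edge_mul_edge]

variable [TopologicalSpace Q] [DiscreteTopology Q] {r : M → Simplex K 0 → Q}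

/-- The principal bundle with discrete fibre `Q` whose coordinate changes are given by a compatible
family. -/
noncomputable def IsCompatibleFamily.core (hr : IsCompatibleFamily z r)
    (hK : TopologicalSpace.IsTopologicalBasis K) : FiberBundleCore (Simplex K 0) M Q where
  baseSet a := a.support
  isOpen_baseSet a := hK.isOpen a.support.2
  indexAt x := (exists_mem_support hK x).choose
  mem_baseSet_at x := (exists_mem_support hK x).choose_spec
  coordChange a b x v := r x b * ((r x a)⁻¹ * v)
  coordChange_self a x _ v := mul_inv_cancel_left _ _
  continuousOn_coordChange a b := by
    rintro ⟨x, v⟩ ⟨⟨ha, hb⟩, -⟩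
    -- The family `r` need not be continuous in `x`, but on `m ⊆ a ∩ b` the factor `r x m` cancels
    -- from the coordinate change, which is therefore locally constant.
    obtain ⟨m, hx, hma, hmb⟩ := exists_le_le_of_mem hK ha hb
    apply ContinuousAt.continuousWithinAt
    have hc : Continuous fun p : M × Q => z.toFun (Simplex.edge m b hmb) *
        ((z.toFun (Simplex.edge m a hma))⁻¹ * p.2) :=
      (continuous_of_discreteTopology (f := fun v : Q => z.toFun (Simplex.edge m b hmb) *
        ((z.toFun (Simplex.edge m a hma))⁻¹ * v))).comp continuous_snd
    refine hc.continuousAt.congr ?_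
    filter_upwards [continuous_fst.continuousAt ((hK.isOpen m.support.2).mem_nhds hx)] with p hp
    rw [hr p.1 m a hma hp, hr p.1 m b hmb hp]
    group
  coordChange_comp a b c x _ v := by group

namespace IsCompatibleFamily

variable (hr : IsCompatibleFamily z r) (hK : TopologicalSpace.IsTopologicalBasis K)

theorem isCoveringMap_proj : IsCoveringMap (hr.core hK).proj :=
  .mk _ (fun _ => Q) (hr.core hK).localTrivAt fun x => (hr.core hK).mem_localTrivAt_baseSet x

/-- The point of the bundle over `x` whose coordinate in the chart `a` is `r x a * q`. -/
noncomputable def lift (x : M) (q : Q) : (hr.core hK).proj ⁻¹' {x} :=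
  ⟨⟨x, r x ((hr.core hK).indexAt x) * q⟩, rfl⟩

theorem lift_injective (x : M) : Function.Injective (hr.lift hK x) := by
  intro q q' h
  have h' := congrArg (fun e => (e.1.2 : Q)) h
  exact mul_left_cancel h'

/-- Inside one chart a path lifts with constant fibre coordinate. The hypothesis says that the two
points have the same coordinate in the chart `a`. -/
theorem monodromy_lift {a : Simplex K 0} {x y : M} (γ : Path x y)
    (hγ : ∀ t, γ t ∈ (a.support : Set M)) {q q' : Q} (h : r x a * q = r y a * q') :
    (hr.isCoveringMap_proj hK).monodromy (.mk γ) (hr.lift hK x q) = hr.lift hK y q' := by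
  have hc : Continuous fun t : I =>
      ((hr.core hK).localTriv a).toOpenPartialHomeomorph.symm (γ t, r x a * q) := by
    rw [← continuousOn_univ]
    refine ((hr.core hK).localTriv a).toOpenPartialHomeomorph.continuousOn_symm.comp
      (by fun_prop) fun t _ => ?_
    exact ((hr.core hK).mem_localTriv_target a _).2 (hγ t)
  refine (hr.isCoveringMap_proj hK).monodromy_eq_of_map_eq
    (.mk ⟨⟨_, hc⟩, ?_, ?_⟩) ?_
  · change (⟨γ 0, r (γ 0) _ * ((r (γ 0) a)⁻¹ * (r x a * q))⟩ : (hr.core hK).TotalSpace) = _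
    rw [γ.source, inv_mul_cancel_left]
    rfl
  · change (⟨γ 1, r (γ 1) _ * ((r (γ 1) a)⁻¹ * (r x a * q))⟩ : (hr.core hK).TotalSpace) = _
    rw [γ.target, h, inv_mul_cancel_left]
    rfl
  · rfl

end IsCompatibleFamily

variable (B : BasePoints K x₀ a₀) (hsc : ∀ U : K, IsSimplyConnected (U : Set M))
  (hr : IsCompatibleFamily z r) (hK : TopologicalSpace.IsTopologicalBasis K)

-- In chart coordinates, transport along the image of `p` is left multiplication by `z(p)`. For a
-- single 1-simplex `b` this is read in the chart |b|: compatibility of `r` passes from the charts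
-- of the vertices to |b|, and `cone_edge` leaves the factor `z(b)`.
include hr hK in
theorem monodromy_onPath (hz : z.IsCocycle) {a : Simplex K 0} (p : SPath a₀ a) {q q' : Q}
    (h : z.onPath p * (r x₀ a₀ * q) = r (B.point a) a * q') :
    (hr.isCoveringMap_proj hK).monodromy
      (Path.Homotopic.Quotient.trans ((B.cochain hsc).onPath p) (B.path (B.point a)))
      (hr.lift hK x₀ q) = hr.lift hK (B.point a) q' := by
  revert q'
  refine SPath.simplices_induction (P := fun a l => ∀ {q' : Q},
    (l.map z.toFun).prod * (r x₀ a₀ * q) = r (B.point a) a * q' →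
      (hr.isCoveringMap_proj hK).monodromy (Path.Homotopic.Quotient.trans
        ((l.map (B.cochain hsc).toFun).prod : FundamentalGroup M x₀) (B.path (B.point a)))
        (hr.lift hK x₀ q) = hr.lift hK (B.point a) q') ?_ ?_ p
  · intro q' h
    rw [List.map_nil, List.prod_nil, one_mul] at h
    -- The point of `a₀` is generalized to a variable so that its equality with `x₀` can be
    -- substituted in the dependent types.
    have key : ∀ y, y = x₀ → ∀ q', r x₀ a₀ * q = r y a₀ * q' →
        (hr.isCoveringMap_proj hK).monodromy
          (Path.Homotopic.Quotient.trans (.refl x₀) (B.path y)) (hr.lift hK x₀ q) =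
            hr.lift hK y q' := by
      rintro y hy q' h
      subst hy
      rw [B.path_base, Path.Homotopic.Quotient.refl_trans, IsCoveringMap.monodromy_refl,
        mul_left_cancel h]
      rfl
    exact key _ B.point_base q' h
  · intro b l ih q' h
    rw [List.map_cons, List.prod_cons, mul_assoc] at h
    -- The loop of `b` followed by the path to the point of `∂₀ b` is the path to the point of `∂₁
    -- b` followed by a segment inside |b|.
    have e : Path.Homotopic.Quotient.trans
        (((b :: l).map (B.cochain hsc).toFun).prod : FundamentalGroup M x₀)
          (B.path (B.point (b.face 0))) =
        (Path.Homotopic.Quotient.trans ((l.map (B.cochain hsc).toFun).prod :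
          FundamentalGroup M x₀) (B.path (B.point (b.face 1)))).trans
          (segmentClass (hsc b.support) (b.support_face_le 1 (B.point_mem (b.face 1)))
            (b.support_face_le 0 (B.point_mem (b.face 0)))) := by
      rw [List.map_cons, List.prod_cons, FundamentalGroup.mul_def,
        Path.Homotopic.Quotient.trans_assoc, Path.Homotopic.Quotient.trans_assoc,
        ← closeUp_trans_path]
      rfl
    rw [e, IsCoveringMap.monodromy_trans_apply, ih
      (q' := (r (B.point (b.face 1)) (b.face 1))⁻¹ * ((l.map z.toFun).prod * (r x₀ a₀ * q)))
      (mul_inv_cancel_left _ _).symm]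
    refine hr.monodromy_lift hK (a := Simplex.zeroEquiv.symm b.support) _
      ((hsc b.support).isPathConnected.joinedIn _ (b.support_face_le 1 (B.point_mem (b.face 1))) _
        (b.support_face_le 0 (B.point_mem (b.face 0)))).somePath_mem ?_
    -- The apex is |b| itself, viewed as a 0-simplex.
    have hb := hz.cone_edge b (Simplex.zeroEquiv.symm b.support) le_rfl
    rw [hr _ (b.face 1) _ (b.support_face_le 1) (B.point_mem _),
      hr _ (b.face 0) _ (b.support_face_le 0) (B.point_mem _), mul_assoc, mul_assoc,
      mul_inv_cancel_left, ← h, ← mul_assoc (z.toFun _) (z.toFun b)]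
    exact congrArg (· * ((l.map z.toFun).prod * (r x₀ a₀ * q))) hb.symm

-- A loop `p` in the kernel has the same monodromy as the constant loop on the covering given by the
-- universal cocycle. The fibre coordinates then agree, and they record the classes of the two
-- loops.
include hK in
theorem BasePoints.toMonoidHom_injective [PreconnectedSpace M] :
    Function.Injective ((B.cochain_isCocycle hsc).toMonoidHom a₀) := by
  rw [injective_iff_map_eq_one]
  rintro ⟨p⟩ hp
  obtain ⟨w, hw⟩ := SPath.exists_basePaths (a₀ := a₀)
    (nonempty_sPath hK (fun a => ⟨_, B.point_mem a⟩) a₀)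
  have hz := universalCochain_isCocycle w hw
  obtain ⟨r, hr⟩ := hz.exists_isCompatibleFamily hK
  let _ : TopologicalSpace (HomotopyGroup a₀) := ⊥
  have : DiscreteTopology (HomotopyGroup a₀) := ⟨rfl⟩
  have key := fun q : SPath a₀ a₀ => monodromy_onPath B hsc hr hK hz q (q := 1)
    (mul_inv_cancel_left (r (B.point a₀) a₀) _).symm
  have h := key p
  rw [show (B.cochain hsc).onPath p = (B.cochain hsc).onPath (SPath.const a₀) from
    hp.trans ((B.cochain_isCocycle hsc).onPath_const a₀).symm, key] at h
  have h' := mul_right_cancel (mul_left_cancel (hr.lift_injective hK _ h))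
  rw [universalCochain_onPath_loop w hw, universalCochain_onPath_loop w hw] at h'
  exact h'.symm

end Covering

end PosetCohomology

/-! ### The two equivalences of categories. -/

open PosetCohomology in
theorem corollary3p9 {M : Type*} [TopologicalSpace M] [T2Space M] [PathConnectedSpace M]
    (K : Set (Set M)) (hK : TopologicalSpace.IsTopologicalBasis K)
    (hconn : ∀ U ∈ K, IsPathConnected U ∧ IsSimplyConnected U)
    (G : Type*) [Group G] (x₀ : M) (a₀ : Simplex K 0) (hx₀ : x₀ ∈ (a₀.support : Set M)) :
    Nonempty (HomCat (FundamentalGroup M x₀) G ≌ HomCat (HomotopyGroup a₀) G) ∧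
      Nonempty (HomCat (HomotopyGroup a₀) G ≌ OneCocycle K G) := by
  have hsc : ∀ U : K, IsSimplyConnected (U : Set M) := fun U => (hconn U U.2).2
  have hne : ∀ a : Simplex K 0, (a.support : Set M).Nonempty := fun a =>
    (hsc a.support).nonempty
  obtain ⟨B⟩ := BasePoints.nonempty hne hx₀
  obtain ⟨w, hw⟩ := SPath.exists_basePaths (nonempty_sPath hK hne a₀)
  have := homToCocycle_isEquivalence (G := G) w hw
  exact ⟨⟨HomCat.congr (MulEquiv.ofBijective _ ⟨B.toMonoidHom_injective hsc hK,
    B.toMonoidHom_surjective hsc hK hx₀⟩).symm⟩, ⟨(homToCocycle w hw).asEquivalence⟩⟩
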